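/- **Theorem 4.2.** *Setting.* Let $M\ge 2$ and let $f_0,\dots,f_{M-1}$ be probability densities with respect to a common measure on a measurable space $\mathcal X$ such that $0<\mathbf E_m\left[\log\frac{f_m(X)}{f_{m'}(X)}\right]<\infty$ for all $m\ne m'$. Under $\mathbf P_m$ a single sensor observes raw data $X_1,X_2,\dots$ that are i.i.d. with density $f_m$, and at time $n$ it sends to a fusion center a binary message $U_n=\phi_n(X_n;V_{n-1})\in\{0,1\}$, where the feedback $V_{n-1}=\psi_n(U_1,\dots,U_{n-1})$ is a function of the past messages. All rules are measurable. The quantizers may be randomized, at each time by private randomization of the sensor, and the fusion center may use an external randomization that it knows, on which the feedback may also depend; all randomizations are independent of the raw data, with a distribution that does not depend on $m$. A decentralized sequential test $\delta$ consists of such rules for the messages and the feedback, a stopping time $N\in\{0,1,2,\dots\}\cup\{\infty\}$ and a final decision $D\in\{0,\dots,M-1\}$, both based only on the messages received up to time $N$ and on the randomization known to the fusion center. The event $\{D\neq m\}$ means that the test stops and decides for a state other than $m$. *Maximin information number.* For a deterministic quantizer, i.e. a measurable $\phi:\mathcal X\to\{0,1\}$, put $f_m(u;\phi)=\mathbf P_m(\phi(X)=u)$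 and $I(m,m';\phi)=\sum_{u\in\{0,1\}}f_m(u;\phi)\log\frac{f_m(u;\phi)}{f_{m'}(u;\phi)}$ (with $0\log\frac00=0$). For a randomized quantizer $\bar\phi=\sum_j p^j\phi^j$ that assigns probabilities $p^j$ to at most countably many deterministic quantizers $\phi^j$, put $I(m,m';\bar\phi)=\sum_j p^jI(m,m';\phi^j)$, $I(m;\bar\phi)=\min_{m'\ne m}I(m,m';\bar\phi)$, and $I(m)=\sup_{\bar\phi}I(m;\bar\phi)$. *Claim.* Let $\delta(c)$, $c>0$, be decentralized sequential tests (not necessarily two-stage tests) such that $$\mathbf P_m\{D\ne m\}=O(c\log c)\quad\text{as }c\to0^+,\qquad m=0,\dots,M-1.$$ Then for every $m=0,\dots,M-1$ we have $0<I(m)<\infty$, and the number $N$ of time steps taken by $\delta(c)$ satisfies, as $c\to 0^+$, $$\mathbf E_m\{N\}\ \ge\ \frac{|\log c|-\log|\log c|+O(1)}{I(m)}\ =\ (1+o(1))\,\frac{|\log c|}{I(m)}.$$ -/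

import Mathlib

open MeasureTheory ProbabilityTheory Filter Topology Asymptotics
open scoped ENNReal

noncomputable section

/-- `M` simple hypotheses about the distribution of a raw observation with values in `𝒳`:
under hypothesis `m` it has probability density `f m` with respect to the common measure `base`. -/
structure Hypotheses (𝒳 : Type*) [MeasurableSpace 𝒳] (M : ℕ) where
  base : Measure 𝒳
  f : Fin M → 𝒳 → ℝ
  measurable_f : ∀ m, Measurable (f m)
  nonneg_f : ∀ m x, 0 ≤ f m x
  lintegral_f : ∀ m, ∫⁻ x, ENNReal.ofReal (f m x) ∂base = 1

namespace Hypotheses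

variable {𝒳 : Type*} [MeasurableSpace 𝒳] {M : ℕ} (H : Hypotheses 𝒳 M)

/-- The law of one raw observation under hypothesis `m`. -/
def law (m : Fin M) : Measure 𝒳 :=
  H.base.withDensity fun x => ENNReal.ofReal (H.f m x)

instance (m : Fin M) : IsProbabilityMeasure (H.law m) :=
  ⟨by rw [law, withDensity_apply _ MeasurableSet.univ, Measure.restrict_univ, H.lintegral_f m]⟩

/-- For any two different states, `0 < E_m [log (f_m(X) / f_{m'}(X))] < ∞`.  The log-likelihood
ratio equals `+∞` where `f_{m'} = 0 < f_m`, so finiteness of its expectation under `m` means that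
`f_{m'}` does not vanish, up to an event of probability zero under `m`, and that the (then
real-valued) log-likelihood ratio is integrable. -/
def PosFiniteDivergence : Prop :=
  ∀ m m' : Fin M, m ≠ m' →
    (∀ᵐ x ∂(H.law m), H.f m' x ≠ 0) ∧
    Integrable (fun x => Real.log (H.f m x / H.f m' x)) (H.law m) ∧
    0 < ∫ x, Real.log (H.f m x / H.f m' x) ∂(H.law m)

end Hypotheses

/-- A deterministic binary quantizer. -/
structure Quantizer (𝒳 : Type*) [MeasurableSpace 𝒳] where
  toFun : 𝒳 → Fin 2
  measurable_toFun : Measurable toFun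

/-- A (possibly randomized) quantizer `∑ⱼ pʲ φʲ`: probability weights `p j` on an at most countable
family of deterministic quantizers.  Weights may vanish, so finite randomizations and deterministic
quantizers are included. -/
structure RandomizedQuantizer (𝒳 : Type*) [MeasurableSpace 𝒳] where
  p : ℕ → ℝ
  nonneg_p : ∀ j, 0 ≤ p j
  hasSum_p : HasSum p 1
  quantizer : ℕ → Quantizer 𝒳

namespace Hypotheses

variable {𝒳 : Type*} [MeasurableSpace 𝒳] {M : ℕ} (H : Hypotheses 𝒳 M)

/-- The probability mass function `f_m(u; φ) = P_m(φ(X) = u)` of the quantized message. -/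
def msgProb (m : Fin M) (φ : Quantizer 𝒳) (u : Fin 2) : ℝ :=
  (H.law m).real {x | φ.toFun x = u}

/-- The Kullback-Leibler divergence `I(m, m'; φ)` of a deterministic quantizer, with
`0 log (0/0) = 0`. -/
def infoDet (m m' : Fin M) (φ : Quantizer 𝒳) : ℝ :=
  ∑ u : Fin 2, H.msgProb m φ u * Real.log (H.msgProb m φ u / H.msgProb m' φ u)

/-- The divergence `I(m, m'; φ̄) = ∑ⱼ pʲ I(m, m'; φʲ)` of a randomized quantizer. -/
def infoRand (m m' : Fin M) (φ : RandomizedQuantizer 𝒳) : ℝ :=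
  ∑' j, φ.p j * H.infoDet m m' (φ.quantizer j)

/-- `I(m; φ̄) = min_{m' ≠ m} I(m, m'; φ̄)`. -/
def leastInfo (m : Fin M) (φ : RandomizedQuantizer 𝒳) : ℝ :=
  ⨅ m' : {m' : Fin M // m' ≠ m}, H.infoRand m m' φ

/-- The maximin information number `I(m) = sup_φ̄ I(m; φ̄)`. -/
def maximinInfo (m : Fin M) : ℝ :=
  ⨆ φ : RandomizedQuantizer 𝒳, H.leastInfo m φ

end Hypotheses

/-- A decentralized sequential test with one sensor, binary messages and full feedback, in which
the local memory is restricted to past decisions.  Times are numbered from `0`, so `n` messages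
have been sent before the observation `X n` is made.

The fusion center may use an external randomization `ξ : Fusion`, which it knows (so that it may,
for example, pick a deterministic quantizer at random and communicate its choice through the
feedback).  The sensor may use at each time `n` a fresh private randomization `l n : Local`, not
known to the fusion center.  Both are trivial for a nonrandomized test. -/
structure DecentralizedTest (𝒳 : Type*) [MeasurableSpace 𝒳] (M : ℕ) where
  /-- the space of feedback values -/
  Feedback : Type*
  [measurableSpaceFeedback : MeasurableSpace Feedback]
  /-- the randomization available to the fusion center -/
  Fusion : Type*
  [measurableSpaceFusion : MeasurableSpace Fusion]
  fusionLaw : Measure Fusion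
  [isProbFusion : IsProbabilityMeasure fusionLaw]
  /-- the private randomization of the sensor at one time step -/
  Local : Type*
  [measurableSpaceLocal : MeasurableSpace Local]
  localLaw : Measure Local
  [isProbLocal : IsProbabilityMeasure localLaw]
  /-- the feedback sent to the sensor after the first `n` messages -/
  ψ : (n : ℕ) → Fusion → (Fin n → Fin 2) → Feedback
  measurable_ψ : ∀ n u, Measurable fun ξ => ψ n ξ u
  /-- the quantizer used at time `n`: a function of the raw observation, of the private
  randomization, and of the feedback -/
  φ : ℕ → 𝒳 → Local → Feedback → Fin 2
  measurable_φ : ∀ n, Measurable fun a : 𝒳 × Local × Feedback => φ n a.1 a.2.1 a.2.2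
  /-- whether the fusion center stops once it has received the given `n` messages -/
  halts : (n : ℕ) → Fusion → (Fin n → Fin 2) → Prop
  measurableSet_halts : ∀ n u, MeasurableSet {ξ | halts n ξ u}
  /-- the decision made if the fusion center stops with the given `n` messages -/
  decision : (n : ℕ) → Fusion → (Fin n → Fin 2) → Fin M
  measurable_decision : ∀ n u, Measurable fun ξ => decision n ξ u

namespace DecentralizedTest

attribute [instance] measurableSpaceFeedback measurableSpaceFusion measurableSpaceLocal
  isProbFusion isProbLocal

variable {𝒳 : Type*} [MeasurableSpace 𝒳] {M : ℕ} (δ : DecentralizedTest 𝒳 M)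

/-- The sample space: randomization of the fusion center, private randomizations of the sensor, and
raw data. -/
abbrev Sample : Type _ := δ.Fusion × (ℕ → δ.Local) × (ℕ → 𝒳)

/-- The probability measure `P_m` on the sample space: the raw data are i.i.d. with density `f_m`,
and independent of all the randomizations, whose distribution does not depend on `m`. -/
def prob (H : Hypotheses 𝒳 M) (m : Fin M) : Measure δ.Sample :=
  δ.fusionLaw.prod
    ((Measure.infinitePi fun _ : ℕ => δ.localLaw).prod (Measure.infinitePi fun _ : ℕ => H.law m))

/-- The first `n` messages received by the fusion center. -/
def messages (ω : δ.Sample) : (n : ℕ) → Fin n → Fin 2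
  | 0 => Fin.elim0
  | n + 1 => Fin.snoc (messages ω n) (δ.φ n (ω.2.2 n) (ω.2.1 n) (δ.ψ n ω.1 (messages ω n)))

/-- The stopping time `N`, i.e. the number of time steps taken: the first `n` at which the fusion
center stops, and `⊤` if it never stops. -/
def N (ω : δ.Sample) : ℕ∞ :=
  ⨅ (n : ℕ) (_ : δ.halts n ω.1 (δ.messages ω n)), (n : ℕ∞)

/-- The expectation `E_m N`. -/
def expectedN (H : Hypotheses 𝒳 M) (m : Fin M) : ℝ≥0∞ :=
  ∫⁻ ω, (δ.N ω : ℝ≥0∞) ∂(δ.prob H m)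

/-- The event `D ≠ m`: the test stops and the final decision differs from `m`. -/
def wrongDecision (m : Fin M) : Set δ.Sample :=
  {ω | ∃ n : ℕ, δ.N ω = n ∧ δ.decision n ω.1 (δ.messages ω n) ≠ m}

/-- The error probability `P_m (D ≠ m)`. -/
def errorProb (H : Hypotheses 𝒳 M) (m : Fin M) : ℝ :=
  (δ.prob H m).real (δ.wrongDecision m)

end DecentralizedTest

end

/-! Fix the true state `m`. Randomizing between quantizers makes the set of vectors of divergences
from `m` to the alternatives convex, and every such vector has a coordinate at most `I(m)`.
Separating this set from an open orthant gives least favourable weights `w` on the alternatives with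
`∑ w m' * I(m, m'; φ) ≤ I(m)` for every single deterministic quantizer
(`exists_weights_sum_mul_infoDet_le`). So each message, whichever quantizer the feedback selects,
yields at most `I(m)` of `w`-averaged information.

Once all randomizations are fixed, a test is a stopped path in a binary tree. A Donsker–Varadhan
inequality propagated through the tree (`sum_stopped_add_sum_alive_le`) bounds `E_m[g] - E_{m'}[exp
g - 1]` at the stopping node by the expected sum of the divergences spent. Taking `g = s` on `{D =
m}` and `0` elsewhere, averaging with `w` and integrating over the randomizations gives, up to
truncation at a horizon, `s P_m(D = m) - (exp s - 1) ∑ w m' P_{m'}(D = m) ≤ I(m) E_m N`.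

If `α` bounds all error probabilities, the choice `s = -log α` yields `I(m) E_m N ≥ |log α| - 2`,
and `α = K c |log c|` gives the claim. The variational form needs neither log-likelihood martingales
nor optional stopping. -/

noncomputable section

/-! ### Divergence inequalities for finite probability vectors -/

/-- The Donsker–Varadhan inequality for two probability vectors. -/
theorem sum_mul_le_log_sum_add_sum_mul_log {ι : Type*} [Fintype ι] {p q : ι → ℝ}
    (hp : ∀ i, 0 ≤ p i) (hq : ∀ i, 0 ≤ q i) (hp1 : ∑ i, p i = 1) (hac : ∀ i, q i = 0 → p i = 0)
    (h : ι → ℝ) :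
    ∑ i, p i * h i ≤ Real.log (∑ i, q i * Real.exp (h i)) + ∑ i, p i * Real.log (p i / q i) := by
  set S := ∑ i, q i * Real.exp (h i) with hS
  have hSpos : 0 < S := by
    obtain ⟨i, -, hi⟩ : ∃ i ∈ Finset.univ, p i ≠ 0 := by
      by_contra! hc
      rw [Finset.sum_congr rfl hc] at hp1
      simp at hp1
    have hqi : 0 < q i := lt_of_le_of_ne (hq i) fun h0 => hi (hac i h0.symm)
    exact Finset.sum_pos' (fun j _ => mul_nonneg (hq j) (Real.exp_pos _).le)
      ⟨i, Finset.mem_univ i, mul_pos hqi (Real.exp_pos _)⟩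
  -- This is `log x ≤ x - 1` at `x = q i * exp (h i) / (S * p i)`, multiplied by `p i`. The
  -- correction in the last parentheses sums to zero, since the tilted vector `q * exp h / S` is
  -- again a probability vector.
  have key : ∀ i, p i * h i ≤ p i * Real.log S + p i * Real.log (p i / q i)
      + (q i * Real.exp (h i) / S - p i) := by
    intro i
    rcases (hp i).eq_or_lt with h0 | hpos
    · rw [← h0]
      simpa using div_nonneg (mul_nonneg (hq i) (Real.exp_pos _).le) hSpos.le
    · have hqi : 0 < q i := lt_of_le_of_ne (hq i) fun h0 => hpos.ne' (hac i h0.symm)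
      have hlog := Real.log_le_sub_one_of_pos
        (show 0 < q i * Real.exp (h i) / (S * p i) by positivity)
      rw [Real.log_div (by positivity) (by positivity), Real.log_mul hqi.ne' (Real.exp_pos _).ne',
        Real.log_exp, Real.log_mul hSpos.ne' hpos.ne'] at hlog
      rw [Real.log_div hpos.ne' hqi.ne']
      have h2 := mul_le_mul_of_nonneg_left hlog hpos.le
      have h3 : p i * (q i * Real.exp (h i) / (S * p i) - 1)
          = q i * Real.exp (h i) / S - p i := by
        field_simp
      rw [h3] at h2
      linarith
  calc ∑ i, p i * h i ≤ ∑ i, (p i * Real.log S + p i * Real.log (p i / q i)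
      + (q i * Real.exp (h i) / S - p i)) := Finset.sum_le_sum fun i _ => key i
    _ = _ := by
      rw [Finset.sum_add_distrib, Finset.sum_add_distrib, Finset.sum_sub_distrib,
        ← Finset.sum_mul, ← Finset.sum_div, hp1, ← hS, div_self hSpos.ne']
      ring

theorem sum_mul_log_div_nonneg {ι : Type*} [Fintype ι] {p q : ι → ℝ}
    (hp : ∀ i, 0 ≤ p i) (hq : ∀ i, 0 ≤ q i) (hp1 : ∑ i, p i = 1) (hq1 : ∑ i, q i = 1)
    (hac : ∀ i, q i = 0 → p i = 0) :
    0 ≤ ∑ i, p i * Real.log (p i / q i) := by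
  simpa [hq1] using sum_mul_le_log_sum_add_sum_mul_log hp hq hp1 hac 0

theorem sum_mul_log_div_pos {ι : Type*} [Fintype ι] {p q : ι → ℝ}
    (hp : ∀ i, 0 ≤ p i) (hq : ∀ i, 0 ≤ q i) (hp1 : ∑ i, p i = 1) (hq1 : ∑ i, q i = 1)
    (hac : ∀ i, q i = 0 → p i = 0) (hne : p ≠ q) :
    0 < ∑ i, p i * Real.log (p i / q i) := by
  -- The lower bounds sum to zero, so one strict coordinate suffices; two different vectors of equal
  -- mass have one with `p i > q i`.
  have key : ∀ i, p i - q i ≤ p i * Real.log (p i / q i) ∧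
      (0 < p i → p i ≠ q i → p i - q i < p i * Real.log (p i / q i)) := by
    intro i
    rcases (hp i).eq_or_lt with h0 | hpos
    · rw [← h0]
      simpa using hq i
    · have hqi : 0 < q i := lt_of_le_of_ne (hq i) fun h0 => hpos.ne' (hac i h0.symm)
      have hlog : Real.log (p i / q i) = -Real.log (q i / p i) := by
        rw [← Real.log_inv, inv_div]
      have h3 : p i - q i = p i * -(q i / p i - 1) := by field_simp; ring
      rw [hlog, h3]
      refine ⟨mul_le_mul_of_nonneg_left
        (neg_le_neg (Real.log_le_sub_one_of_pos (by positivity))) hpos.le, fun _ hn => ?_⟩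
      refine mul_lt_mul_of_pos_left
        (neg_lt_neg (Real.log_lt_sub_one_of_pos (by positivity) fun h1 => hn ?_)) hpos
      rw [div_eq_one_iff_eq hpos.ne'] at h1
      exact h1.symm
  obtain ⟨i, hi, hni⟩ : ∃ i, 0 < p i ∧ p i ≠ q i := by
    by_contra! hc
    refine hne (funext fun j => ?_)
    have hle : ∀ i, p i ≤ q i := fun i => by
      rcases (hp i).eq_or_lt with h0 | hpos
      · exact h0 ▸ hq i
      · exact (hc i hpos).le
    have := (Finset.sum_eq_sum_iff_of_le (s := Finset.univ) fun i _ => hle i).1 (hp1.trans hq1.symm)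
    exact this j (Finset.mem_univ j)
  calc (0 : ℝ) = ∑ i, (p i - q i) := by rw [Finset.sum_sub_distrib, hp1, hq1, sub_self]
    _ < _ := Finset.sum_lt_sum (fun i _ => (key i).1) ⟨i, Finset.mem_univ i, (key i).2 hi hni⟩

/-! ### Divergences of quantizers and the maximin information number -/

namespace Hypotheses

variable {𝒳 : Type*} [MeasurableSpace 𝒳] {M : ℕ} {H : Hypotheses 𝒳 M}

theorem measurableSet_quantizer_eq (φ : Quantizer 𝒳) (u : Fin 2) :
    MeasurableSet {x | φ.toFun x = u} :=
  φ.measurable_toFun (measurableSet_singleton u)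

theorem msgProb_nonneg (m : Fin M) (φ : Quantizer 𝒳) (u : Fin 2) : 0 ≤ H.msgProb m φ u :=
  measureReal_nonneg

theorem sum_msgProb (m : Fin M) (φ : Quantizer 𝒳) : ∑ u, H.msgProb m φ u = 1 := by
  have h := sum_measureReal_preimage_singleton (μ := H.law m) (f := φ.toFun) Finset.univ
    fun u _ => φ.measurable_toFun (measurableSet_singleton u)
  simp only [Finset.coe_univ, Set.preimage_univ, probReal_univ] at h
  exact h

theorem law_eq_zero_of_law_eq_zero (hH : H.PosFiniteDivergence) {m m' : Fin M} (hm : m' ≠ m)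
    {s : Set 𝒳} (hs : MeasurableSet s) (h0 : H.law m' s = 0) : H.law m s = 0 := by
  have hf : ∀ j, Measurable fun x => ENNReal.ofReal (H.f j x) := fun j =>
    (H.measurable_f j).ennreal_ofReal
  have h1 := (hH m m' hm.symm).1
  rw [law, ae_withDensity_iff (hf m)] at h1
  rw [law, withDensity_apply _ hs, lintegral_eq_zero_iff (hf m'), EventuallyEq,
    ae_restrict_iff' hs] at h0
  rw [law, withDensity_apply _ hs, lintegral_eq_zero_iff (hf m), EventuallyEq,
    ae_restrict_iff' hs]
  filter_upwards [h0, h1] with x hx0 hx1 hxs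
  by_contra hc
  have := hx0 hxs
  simp only [Pi.zero_apply, ENNReal.ofReal_eq_zero] at this
  exact hx1 hc (le_antisymm this (H.nonneg_f m' x))

theorem msgProb_eq_zero (hH : H.PosFiniteDivergence) {m m' : Fin M} (hm : m' ≠ m)
    (φ : Quantizer 𝒳) (u : Fin 2) (h0 : H.msgProb m' φ u = 0) : H.msgProb m φ u = 0 := by
  rw [msgProb, measureReal_eq_zero_iff] at h0 ⊢
  exact law_eq_zero_of_law_eq_zero hH hm (measurableSet_quantizer_eq φ u) h0

theorem infoDet_nonneg (hH : H.PosFiniteDivergence) {m m' : Fin M} (hm : m' ≠ m)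
    (φ : Quantizer 𝒳) : 0 ≤ H.infoDet m m' φ :=
  sum_mul_log_div_nonneg (msgProb_nonneg m φ) (msgProb_nonneg m' φ) (sum_msgProb m φ)
    (sum_msgProb m' φ) (msgProb_eq_zero hH hm φ)

/-- Indicators of measurable sets are quantizers. If none of them had positive divergence, the two
laws would agree on every set, the densities would agree almost everywhere, and the divergence of
the raw data would vanish. -/
theorem exists_infoDet_pos (hH : H.PosFiniteDivergence) {m m' : Fin M} (hm : m' ≠ m) :
    ∃ φ : Quantizer 𝒳, 0 < H.infoDet m m' φ := by
  by_contra! hc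
  have hf : ∀ j, Measurable fun x => ENNReal.ofReal (H.f j x) := fun j =>
    (H.measurable_f j).ennreal_ofReal
  have hlaw : H.law m = H.law m' := by
    ext s hs
    classical
    let φ : Quantizer 𝒳 := ⟨fun x => if x ∈ s then 1 else 0,
      Measurable.ite hs measurable_const measurable_const⟩
    have hφ : {x | φ.toFun x = 1} = s := by
      ext x
      simp [φ]
    have heq : H.msgProb m φ = H.msgProb m' φ := by
      by_contra hne
      exact absurd (sum_mul_log_div_pos (msgProb_nonneg m φ) (msgProb_nonneg m' φ)
        (sum_msgProb m φ) (sum_msgProb m' φ) (msgProb_eq_zero hH hm φ) hne) (not_lt.2 (hc φ))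
    have h1 := congrFun heq 1
    simp only [msgProb, hφ] at h1
    exact (measureReal_eq_measureReal_iff).1 h1
  have hae : (fun x => ENNReal.ofReal (H.f m x)) =ᵐ[H.base] fun x => ENNReal.ofReal (H.f m' x) :=
    (withDensity_eq_iff (hf m).aemeasurable (hf m').aemeasurable
      (by rw [H.lintegral_f m]; simp)).1 hlaw
  have hae' : ∀ᵐ x ∂H.law m, Real.log (H.f m x / H.f m' x) = 0 := by
    rw [law, ae_withDensity_iff (hf m)]
    filter_upwards [hae] with x hx hx0
    have : H.f m x = H.f m' x :=
      (ENNReal.ofReal_eq_ofReal_iff (H.nonneg_f m x) (H.nonneg_f m' x)).1 hx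
    rw [this]
    by_cases h0 : H.f m' x = 0
    · simp [h0]
    · simp [div_self h0]
  have := (hH m m' hm.symm).2.2
  rw [integral_congr_ae hae'] at this
  simp at this

/-- The log-sum inequality on one measurable set. -/
theorem mul_log_div_le_setIntegral (hH : H.PosFiniteDivergence) {m m' : Fin M} (hm : m' ≠ m)
    {s : Set 𝒳} (hs : MeasurableSet s) :
    (H.law m).real s * Real.log ((H.law m).real s / (H.law m').real s)
      ≤ ∫ x in s, Real.log (H.f m x / H.f m' x) ∂H.law m := by
  obtain ⟨hne, hint, -⟩ := hH m m' hm.symm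
  have hf : ∀ j, Measurable fun x => ENNReal.ofReal (H.f j x) := fun j =>
    (H.measurable_f j).ennreal_ofReal
  set p := (H.law m).real s with hp
  set q := (H.law m').real s with hq
  rcases (measureReal_nonneg (μ := H.law m) (s := s)).eq_or_lt with h0 | hpos
  · rw [← hp] at h0
    rw [← h0, zero_mul, Measure.restrict_eq_zero.2, integral_zero_measure]
    exact (measureReal_eq_zero_iff).1 (hp ▸ h0.symm)
  rw [← hp] at hpos
  have hqpos : 0 < q := by
    refine lt_of_le_of_ne measureReal_nonneg fun h0 => hpos.ne' ?_
    exact (measureReal_eq_zero_iff).2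
      (law_eq_zero_of_law_eq_zero hH hm hs ((measureReal_eq_zero_iff).1 h0.symm))
  have hfpos : ∀ᵐ x ∂H.law m, 0 < H.f m x := by
    rw [law, ae_withDensity_iff (hf m)]
    filter_upwards with x hx
    simpa using hx
  -- Only an inequality: `f m'` may charge a set where `f m` vanishes.
  have hlin : ∫⁻ x in s, ENNReal.ofReal (H.f m' x / H.f m x) ∂H.law m ≤ H.law m' s := by
    have hmeas : Measurable fun x => ENNReal.ofReal (H.f m' x / H.f m x) :=
      ((H.measurable_f m').div (H.measurable_f m)).ennreal_ofReal
    rw [law, restrict_withDensity hs, lintegral_withDensity_eq_lintegral_mul _ (hf m) hmeas, law, withDensity_apply _ hs]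
    refine lintegral_mono fun x => ?_
    simp only [Pi.mul_apply]
    rw [← ENNReal.ofReal_mul (H.nonneg_f m x)]
    refine ENNReal.ofReal_le_ofReal ?_
    by_cases h0 : H.f m x = 0
    · simpa [h0] using H.nonneg_f m' x
    · rw [mul_div_cancel₀ _ h0]
  have hnn : ∀ x, 0 ≤ H.f m' x / H.f m x := fun x => div_nonneg (H.nonneg_f m' x) (H.nonneg_f m x)
  have hrint : Integrable (fun x => H.f m' x / H.f m x) ((H.law m).restrict s) := by
    refine ⟨((H.measurable_f m').div (H.measurable_f m)).aestronglyMeasurable, ?_⟩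
    rw [hasFiniteIntegral_iff_ofReal (Eventually.of_forall hnn)]
    exact hlin.trans_lt (measure_lt_top _ _)
  have hrle : ∫ x in s, H.f m' x / H.f m x ∂H.law m ≤ q := by
    rw [integral_eq_lintegral_of_nonneg_ae (Eventually.of_forall hnn) hrint.1, hq, measureReal_def]
    exact ENNReal.toReal_mono (measure_ne_top _ _) hlin
  -- The tangent bound `log t ≤ t - 1` at `t = (p / q) * (f m' / f m)`. After integration over `s`
  -- the constant term contributes `p` and the last one at most `p`, so they cancel in the right
  -- direction.
  have hpt : ∀ᵐ x ∂(H.law m).restrict s,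
      Real.log (p / q) + 1 - p / q * (H.f m' x / H.f m x) ≤ Real.log (H.f m x / H.f m' x) := by
    filter_upwards [ae_restrict_of_ae hne, ae_restrict_of_ae hfpos] with x hx hx'
    have hx2 : 0 < H.f m' x := lt_of_le_of_ne (H.nonneg_f m' x) (Ne.symm hx)
    have hl := Real.log_le_sub_one_of_pos
      (show 0 < p / q * (H.f m' x / H.f m x) by positivity)
    rw [Real.log_mul (by positivity) (by positivity), Real.log_div hx2.ne' hx'.ne'] at hl
    rw [Real.log_div hx'.ne' hx2.ne']
    linarith
  have hfin := integral_mono_ae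
    ((integrable_const _).sub (hrint.const_mul (p / q))) hint.integrableOn hpt
  rw [integral_sub' (integrable_const _) (hrint.const_mul _), integral_const, integral_const_mul,
    measureReal_restrict_apply_univ, ← hp, smul_eq_mul] at hfin
  have h4 : p / q * ∫ x in s, H.f m' x / H.f m x ∂H.law m ≤ p := by
    calc _ ≤ p / q * q := mul_le_mul_of_nonneg_left hrle (by positivity)
      _ = p := div_mul_cancel₀ _ hqpos.ne'
  nlinarith

/-- Quantization does not increase the divergence. -/
theorem infoDet_le (hH : H.PosFiniteDivergence) {m m' : Fin M} (hm : m' ≠ m) (φ : Quantizer 𝒳) :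
    H.infoDet m m' φ ≤ ∫ x, Real.log (H.f m x / H.f m' x) ∂H.law m := by
  have h := Finset.sum_le_sum fun (u : Fin 2) (_ : u ∈ Finset.univ) =>
    mul_log_div_le_setIntegral hH hm (measurableSet_quantizer_eq φ u)
  refine h.trans_eq ?_
  rw [← integral_biUnion_finset _ (fun u _ => measurableSet_quantizer_eq φ u)]
  · have : (⋃ u ∈ (Finset.univ : Finset (Fin 2)), {x | φ.toFun x = u}) = Set.univ := by
      ext x
      simp
    rw [this, setIntegral_univ]
  · intro u _ v _ huv
    exact Set.disjoint_left.2 fun x hx hx' => huv (hx.symm.trans hx')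
  · exact fun u _ => (hH m m' hm.symm).2.1.integrableOn

theorem summable_mul_infoDet (hH : H.PosFiniteDivergence) {m m' : Fin M} (hm : m' ≠ m)
    (φ : RandomizedQuantizer 𝒳) : Summable fun j => φ.p j * H.infoDet m m' (φ.quantizer j) :=
  Summable.of_nonneg_of_le (fun j => mul_nonneg (φ.nonneg_p j) (infoDet_nonneg hH hm _))
    (fun j => mul_le_mul_of_nonneg_left (infoDet_le hH hm _) (φ.nonneg_p j))
    (φ.hasSum_p.summable.mul_right _)

theorem infoRand_le (hH : H.PosFiniteDivergence) {m m' : Fin M} (hm : m' ≠ m)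
    (φ : RandomizedQuantizer 𝒳) :
    H.infoRand m m' φ ≤ ∫ x, Real.log (H.f m x / H.f m' x) ∂H.law m := by
  calc H.infoRand m m' φ ≤ ∑' j, φ.p j * ∫ x, Real.log (H.f m x / H.f m' x) ∂H.law m :=
        (summable_mul_infoDet hH hm φ).tsum_le_tsum
          (fun j => mul_le_mul_of_nonneg_left (infoDet_le hH hm _) (φ.nonneg_p j))
          (φ.hasSum_p.summable.mul_right _)
    _ = _ := by rw [tsum_mul_right, φ.hasSum_p.tsum_eq, one_mul]

/-- The divergences from state `m` to all the other states. -/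
def infoVec (H : Hypotheses 𝒳 M) (m : Fin M) (φ : RandomizedQuantizer 𝒳)
    (m' : {m' : Fin M // m' ≠ m}) : ℝ :=
  H.infoRand m m' φ

/-- A mixture of two countable randomizations is again one: the two families are interleaved, one on
the even and one on the odd indices, with weights scaled by `a` and `b`. -/
theorem convex_range_infoVec (hH : H.PosFiniteDivergence) (m : Fin M) :
    Convex ℝ (Set.range (H.infoVec m)) := by
  rintro _ ⟨φ, rfl⟩ _ ⟨χ, rfl⟩ a b ha hb hab
  have heven : ∀ k : ℕ, (2 * k) / 2 = k := fun k => by omega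
  have hodd : ∀ k : ℕ, (2 * k + 1) / 2 = k := fun k => by omega
  refine ⟨⟨fun j => if Even j then a * φ.p (j / 2) else b * χ.p (j / 2), fun j => ?_, ?_,
    fun j => if Even j then φ.quantizer (j / 2) else χ.quantizer (j / 2)⟩, ?_⟩
  · split_ifs
    · exact mul_nonneg ha (φ.nonneg_p _)
    · exact mul_nonneg hb (χ.nonneg_p _)
  · rw [← hab]
    refine HasSum.even_add_odd ?_ ?_
    · simpa [heven] using φ.hasSum_p.mul_left a
    · simpa [hodd, Nat.even_add_one] using χ.hasSum_p.mul_left b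
  · funext m'
    have h1 := (summable_mul_infoDet hH m'.2 φ).hasSum.mul_left a
    have h2 := (summable_mul_infoDet hH m'.2 χ).hasSum.mul_left b
    simp only [infoVec, Pi.add_apply, Pi.smul_apply, smul_eq_mul, infoRand]
    refine HasSum.tsum_eq (HasSum.even_add_odd ?_ ?_)
    · simpa [heven, mul_assoc] using h1
    · simpa [hodd, Nat.even_add_one, mul_assoc] using h2

theorem infoDet_mem_range_infoVec (m : Fin M) (φ : Quantizer 𝒳) :
    (fun m' : {m' : Fin M // m' ≠ m} => H.infoDet m m' φ) ∈ Set.range (H.infoVec m) := by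
  refine ⟨⟨Pi.single 0 1, fun j => ?_, hasSum_pi_single 0 1, fun _ => φ⟩, ?_⟩
  · by_cases h : j = 0
    · subst h; simp
    · simp [h]
  · funext m'
    simp only [infoVec, infoRand]
    rw [tsum_eq_single 0]
    · simp
    · intro j hj
      simp [hj]

theorem nonempty_ne (hM : 2 ≤ M) (m : Fin M) : Nonempty {m' : Fin M // m' ≠ m} := by
  have : Nontrivial (Fin M) := Fin.nontrivial_iff_two_le.2 hM
  obtain ⟨m', hm'⟩ := exists_ne m
  exact ⟨⟨m', hm'⟩⟩

theorem bddAbove_range_leastInfo (hM : 2 ≤ M) (hH : H.PosFiniteDivergence) (m : Fin M) :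
    BddAbove (Set.range (H.leastInfo m)) := by
  obtain ⟨m', hm'⟩ := nonempty_ne hM m
  refine ⟨∫ x, Real.log (H.f m x / H.f m' x) ∂H.law m, ?_⟩
  rintro _ ⟨φ, rfl⟩
  exact (ciInf_le (Set.finite_range _).bddBelow (⟨m', hm'⟩ : {m' : Fin M // m' ≠ m})).trans
    (infoRand_le hH hm' φ)

/-- For each alternative some quantizer is informative against it; the uniform mixture of these is
informative against all alternatives at once. -/
theorem maximinInfo_pos (hM : 2 ≤ M) (hH : H.PosFiniteDivergence) (m : Fin M) :
    0 < H.maximinInfo m := by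
  have := nonempty_ne hM m
  choose φ hφ using fun m' : {m' : Fin M // m' ≠ m} => exists_infoDet_pos hH m'.2
  have hcard : (0 : ℝ) < Fintype.card {m' : Fin M // m' ≠ m} := by
    exact_mod_cast Fintype.card_pos
  obtain ⟨χ, hχ⟩ := (convex_range_infoVec hH m).sum_mem (t := Finset.univ)
    (w := fun _ : {m' : Fin M // m' ≠ m} => (Fintype.card {m' : Fin M // m' ≠ m} : ℝ)⁻¹)
    (fun _ _ => by positivity) (by rw [Finset.sum_const, Finset.card_univ, nsmul_eq_mul, mul_inv_cancel₀ hcard.ne'])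
    fun m' _ => infoDet_mem_range_infoVec m (φ m')
  refine lt_of_lt_of_le ?_ (le_ciSup (bddAbove_range_leastInfo hM hH m) χ)
  obtain ⟨m', hm'⟩ := exists_eq_ciInf_of_finite
    (f := fun m' : {m' : Fin M // m' ≠ m} => H.infoRand m m' χ)
  rw [leastInfo, ← hm']
  have h := congrFun hχ m'
  simp only [infoVec, Finset.sum_apply, Pi.smul_apply, smul_eq_mul] at h
  rw [h]
  exact Finset.sum_pos' (fun i _ => mul_nonneg (by positivity) (infoDet_nonneg hH m'.2 _))
    ⟨m', Finset.mem_univ _, mul_pos (by positivity) (hφ m')⟩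

end Hypotheses

/-! ### Least favourable weights by separation -/

/-- A convex set of vectors with least coordinate at most `a` has a common weighted average
of the coordinates that is at most `a`. -/
theorem Convex.exists_weights_sum_mul_le {ι : Type*} [Fintype ι] {C : Set (ι → ℝ)}
    (hC : Convex ℝ C) (hne : C.Nonempty) (a : ℝ) (ha : ∀ v ∈ C, ∃ i, v i ≤ a) :
    ∃ w : ι → ℝ, (∀ i, 0 ≤ w i) ∧ ∑ i, w i = 1 ∧ ∀ v ∈ C, ∑ i, w i * v i ≤ a := by
  classical
  have hOeq : {v : ι → ℝ | ∀ i, a < v i} = Set.pi Set.univ fun _ => Set.Ioi a := by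
    ext v
    simp
  have hOpen : IsOpen {v : ι → ℝ | ∀ i, a < v i} := by
    rw [hOeq]
    exact isOpen_set_pi Set.finite_univ fun _ _ => isOpen_Ioi
  have hOconv : Convex ℝ {v : ι → ℝ | ∀ i, a < v i} := by
    rw [hOeq]
    exact convex_pi fun _ _ => convex_Ioi a
  obtain ⟨f, u, hf1, hf2⟩ := geometric_hahn_banach_open hOconv hOpen hC
    (Set.disjoint_left.2 fun v hv hvC => by
      obtain ⟨i, hi⟩ := ha v hvC
      exact absurd (hv i) (not_lt.2 hi))
  -- The functional `f` lies below `u` on the orthant `{v | ∀ i, a < v i}` and above `u` on `C`; the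
  -- sign change turns its coefficients into nonnegative weights.
  set w : ι → ℝ := fun i => -f (Pi.single i 1) with hw
  have hfw : ∀ v, f v = -∑ i, w i * v i := by
    intro v
    conv_lhs => rw [← Finset.univ_sum_single v]
    rw [map_sum, ← Finset.sum_neg_distrib]
    refine Finset.sum_congr rfl fun i _ => ?_
    have : (Pi.single i (v i) : ι → ℝ) = v i • Pi.single i (1 : ℝ) := by
      rw [← Pi.single_smul, smul_eq_mul, mul_one]
    rw [this, map_smul, smul_eq_mul, hw]
    ring
  have hwnn : ∀ i, 0 ≤ w i := by
    intro i
    by_contra! hneg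
    set b := f fun _ => a + 1 with hb
    -- With `w i < 0`, moving along the `i`-th axis stays in the orthant and raises `f`; this step
    -- length gives the value `b + |u - b| ≥ u`, which is impossible there.
    have h := hf1 ((fun _ => a + 1) + (|u - b| / -w i) • Pi.single i (1 : ℝ)) (fun j => by
      have : 0 ≤ (Pi.single i (1 : ℝ) : ι → ℝ) j := by
        by_cases hj : j = i
        · subst hj; simp
        · simp [hj]
      have h2 : 0 ≤ |u - b| / -w i := div_nonneg (abs_nonneg _) (by linarith)
      simp only [Pi.add_apply, Pi.smul_apply, smul_eq_mul]
      nlinarith [mul_nonneg h2 this])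
    rw [map_add, map_smul, smul_eq_mul, ← hb] at h
    have h3 : f (Pi.single i 1) = -w i := by simp [hw]
    rw [h3, div_mul_cancel₀ _ (by linarith)] at h
    linarith [le_abs_self (u - b)]
  obtain ⟨v₀, hv₀⟩ := hne
  have hWpos : 0 < ∑ i, w i := by
    refine lt_of_le_of_ne (Finset.sum_nonneg fun i _ => hwnn i) fun h0 => ?_
    have hw0 : ∀ i, w i = 0 := fun i =>
      (Finset.sum_eq_zero_iff_of_nonneg fun i _ => hwnn i).1 h0.symm i (Finset.mem_univ i)
    have h1 := hf1 (fun _ => a + 1) fun _ => by linarith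
    have h2 := hf2 v₀ hv₀
    rw [hfw] at h1 h2
    simp only [hw0, zero_mul, Finset.sum_const_zero] at h1 h2
    linarith
  refine ⟨fun i => w i / ∑ j, w j, fun i => div_nonneg (hwnn i) hWpos.le, ?_, fun v hv => ?_⟩
  · rw [← Finset.sum_div, div_self hWpos.ne']
  · have hle : ∑ i, w i * v i ≤ a * ∑ i, w i := by
      refine le_of_forall_pos_lt_add fun ε hε => ?_
      -- Points of the open orthant approaching its corner, scaled so that the loss is exactly `ε`.
      have h1 := hf1 (fun _ => a + ε / ∑ i, w i) fun _ => by
        have := div_pos hε hWpos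
        linarith
      have h2 := hf2 v hv
      rw [hfw] at h1 h2
      rw [← Finset.sum_mul, mul_add, mul_div_cancel₀ _ hWpos.ne'] at h1
      linarith
    calc ∑ i, w i / (∑ j, w j) * v i = (∑ i, w i * v i) / ∑ j, w j := by
          rw [Finset.sum_div]
          exact Finset.sum_congr rfl fun i _ => by ring
      _ ≤ a := (div_le_iff₀ hWpos).2 hle

namespace Hypotheses

variable {𝒳 : Type*} [MeasurableSpace 𝒳] {M : ℕ} {H : Hypotheses 𝒳 M}

/-- The least favourable weights on the alternatives to `m`. -/
theorem exists_weights_sum_mul_infoDet_le (hM : 2 ≤ M) (hH : H.PosFiniteDivergence) (m : Fin M) :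
    ∃ w : {m' : Fin M // m' ≠ m} → ℝ, (∀ m', 0 ≤ w m') ∧ ∑ m', w m' = 1 ∧
      ∀ φ : Quantizer 𝒳, ∑ m', w m' * H.infoDet m m' φ ≤ H.maximinInfo m := by
  have := nonempty_ne hM m
  obtain ⟨w, hw, hw1, hle⟩ := (convex_range_infoVec hH m).exists_weights_sum_mul_le
    ⟨_, infoDet_mem_range_infoVec m ⟨fun _ => 0, measurable_const⟩⟩ (H.maximinInfo m) (by
      rintro _ ⟨φ, rfl⟩
      obtain ⟨m', hm'⟩ := exists_eq_ciInf_of_finite (f := H.infoVec m φ)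
      refine ⟨m', ?_⟩
      rw [hm']
      exact le_ciSup (bddAbove_range_leastInfo hM hH m) φ)
  exact ⟨w, hw, hw1, fun φ => hle _ (infoDet_mem_range_infoVec m φ)⟩

end Hypotheses

/-! ### Change of measure on a stopped binary tree -/

theorem sum_fin_succ_pi_eq_sum_snoc {n : ℕ} {α β : Type*} [Fintype α] [AddCommMonoid β]
    (F : (Fin (n + 1) → α) → β) :
    ∑ u, F u = ∑ v : Fin n → α, ∑ b, F (Fin.snoc v b) := by
  rw [← (Fin.snocEquiv fun _ => α).sum_comp, Fintype.sum_prod_type, Finset.sum_comm]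
  rfl

/-- No proper prefix of `u` is in the set `S` of stopping nodes. -/
def Alive (S : (n : ℕ) → (Fin n → Fin 2) → Prop) : (n : ℕ) → (Fin n → Fin 2) → Prop
  | 0, _ => True
  | n + 1, u => Alive S n (Fin.init u) ∧ ¬ S n (Fin.init u)

/-- The probability of reaching the node `u` of the binary tree whose transition probabilities are
given by `p`. -/
def pathWeight (p : (n : ℕ) → (Fin n → Fin 2) → Fin 2 → ℝ) : (n : ℕ) → (Fin n → Fin 2) → ℝ
  | 0, _ => 1
  | n + 1, u => pathWeight p n (Fin.init u) * p n (Fin.init u) (u (Fin.last n))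

theorem pathWeight_nonneg {p : (n : ℕ) → (Fin n → Fin 2) → Fin 2 → ℝ}
    (hp : ∀ n u b, 0 ≤ p n u b) (n : ℕ) (u : Fin n → Fin 2) : 0 ≤ pathWeight p n u := by
  induction n with
  | zero => exact zero_le_one
  | succ n ih => exact mul_nonneg (ih _) (hp _ _ _)

open scoped Classical in
/-- The change of measure inequality for a stopped path in a binary tree, in the variational form:
`g` is the value at the stopping nodes, `h` the one at the nodes where the horizon is reached. -/
theorem sum_stopped_add_sum_alive_le
    {p q : (n : ℕ) → (Fin n → Fin 2) → Fin 2 → ℝ}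
    (hp : ∀ n u b, 0 ≤ p n u b) (hq : ∀ n u b, 0 ≤ q n u b)
    (hp1 : ∀ n u, ∑ b, p n u b = 1) (hq1 : ∀ n u, ∑ b, q n u b = 1)
    (hac : ∀ n u b, q n u b = 0 → p n u b = 0) (S : (n : ℕ) → (Fin n → Fin 2) → Prop)
    (g : (n : ℕ) → (Fin n → Fin 2) → ℝ) (n : ℕ) (h : (Fin n → Fin 2) → ℝ) :
    (∑ k ∈ Finset.range n, ∑ u : Fin k → Fin 2, if Alive S k u ∧ S k u then
        pathWeight p k u * g k u - pathWeight q k u * (Real.exp (g k u) - 1) else 0)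
      + (∑ u : Fin n → Fin 2, if Alive S n u then
        pathWeight p n u * h u - pathWeight q n u * (Real.exp (h u) - 1) else 0)
      ≤ ∑ k ∈ Finset.range n, ∑ u : Fin k → Fin 2, if Alive S k u ∧ ¬ S k u then
          pathWeight p k u * ∑ b, p k u b * Real.log (p k u b / q k u b) else 0 := by
  induction n with
  | zero =>
    simp only [Finset.range_zero, Finset.sum_empty, zero_add]
    refine Finset.sum_nonpos fun u _ => ?_
    have h0 := Real.add_one_le_exp (h u)
    rw [if_pos (show Alive S 0 u from trivial)]
    simp only [pathWeight]
    linarith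
  | succ n ih =>
    -- Backward induction: at a continuing node, terminal values one level deeper are replaced by
    -- the log-moment under `q`. Its exponential is the `q`-mean of `exp h`, so the `q`-terms are
    -- unchanged, while Donsker–Varadhan charges the `p`-terms one step of divergence.
    set k : (Fin n → Fin 2) → ℝ := fun u => if S n u then g n u else
      Real.log (∑ b, q n u b * Real.exp (h (Fin.snoc u b))) with hk
    have hih := ih k
    rw [Finset.sum_range_succ, Finset.sum_range_succ _ n]
    suffices hstep : (∑ u : Fin n → Fin 2, if Alive S n u ∧ S n u then
          pathWeight p n u * g n u - pathWeight q n u * (Real.exp (g n u) - 1) else 0)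
        + (∑ u : Fin (n + 1) → Fin 2, if Alive S (n + 1) u then
          pathWeight p (n + 1) u * h u - pathWeight q (n + 1) u * (Real.exp (h u) - 1) else 0)
        ≤ (∑ u : Fin n → Fin 2, if Alive S n u then
          pathWeight p n u * k u - pathWeight q n u * (Real.exp (k u) - 1) else 0)
        + ∑ u : Fin n → Fin 2, if Alive S n u ∧ ¬ S n u then
          pathWeight p n u * ∑ b, p n u b * Real.log (p n u b / q n u b) else 0 by
      linarith
    rw [sum_fin_succ_pi_eq_sum_snoc, ← Finset.sum_add_distrib, ← Finset.sum_add_distrib]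
    refine Finset.sum_le_sum fun u _ => ?_
    simp only [Alive, pathWeight, Fin.init_snoc, Fin.snoc_last]
    by_cases hA : Alive S n u
    swap
    · simp [hA]
    by_cases hS : S n u
    · simp [hA, hS, hk]
    · simp only [hA, hS, hk, if_true, if_false, and_true, and_false, not_false_eq_true, zero_add]
      have hDV := sum_mul_le_log_sum_add_sum_mul_log (hp n u) (hq n u) (hp1 n u) (hac n u)
        fun b => h (Fin.snoc u b)
      set T := ∑ b, q n u b * Real.exp (h (Fin.snoc u b)) with hT
      have hTpos : 0 < T := by
        obtain ⟨b, -, hb⟩ := Finset.exists_ne_zero_of_sum_ne_zero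
          (show ∑ b, q n u b ≠ 0 by rw [hq1]; exact one_ne_zero)
        exact Finset.sum_pos' (fun b _ => mul_nonneg (hq n u b) (Real.exp_pos _).le)
          ⟨b, Finset.mem_univ b, mul_pos ((hq n u b).lt_of_ne' hb) (Real.exp_pos _)⟩
      rw [Real.exp_log hTpos]
      have hL : ∑ b, (pathWeight p n u * p n u b * h (Fin.snoc u b)
            - pathWeight q n u * q n u b * (Real.exp (h (Fin.snoc u b)) - 1))
          = pathWeight p n u * (∑ b, p n u b * h (Fin.snoc u b))
            - pathWeight q n u * (T - 1) := by
        have hT1 : T - 1 = ∑ b, q n u b * (Real.exp (h (Fin.snoc u b)) - 1) := by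
          simp only [mul_sub, mul_one, Finset.sum_sub_distrib, hq1, hT]
        rw [hT1, Finset.mul_sum, Finset.mul_sum,
          ← Finset.sum_sub_distrib]
        exact Finset.sum_congr rfl fun b _ => by ring
      refine hL.trans_le ?_
      have := mul_le_mul_of_nonneg_left hDV (pathWeight_nonneg hp n u)
      linarith

/-! ### Tests with all randomizations fixed -/

/-- The messages sent when the quantizer applied after the messages `u` is `q n u`. -/
def treeMessages {𝒳 : Type*} [MeasurableSpace 𝒳] (q : (n : ℕ) → (Fin n → Fin 2) → Quantizer 𝒳)
    (x : ℕ → 𝒳) : (n : ℕ) → Fin n → Fin 2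
  | 0 => Fin.elim0
  | n + 1 => Fin.snoc (treeMessages q x n) ((q n (treeMessages q x n)).toFun (x n))

namespace Hypotheses

variable {𝒳 : Type*} [MeasurableSpace 𝒳] {M : ℕ} {H : Hypotheses 𝒳 M}

theorem treeMessages_succ_eq_iff (q : (n : ℕ) → (Fin n → Fin 2) → Quantizer 𝒳) (x : ℕ → 𝒳)
    (n : ℕ) (u : Fin (n + 1) → Fin 2) :
    treeMessages q x (n + 1) = u ↔
      treeMessages q x n = Fin.init u ∧ (q n (Fin.init u)).toFun (x n) = u (Fin.last n) := by
  constructor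
  · rintro rfl
    simp [treeMessages]
  · rintro ⟨h1, h2⟩
    rw [treeMessages, h1, h2, Fin.snoc_init_self]

/-- Prescribing the messages determines which quantizer acts at each time, so the event constrains
each observation separately. The resulting box is the same for every state `m`. -/
theorem exists_treeMessages_eq_pi (H : Hypotheses 𝒳 M)
    (q : (n : ℕ) → (Fin n → Fin 2) → Quantizer 𝒳)
    (n : ℕ) (u : Fin n → Fin 2) :
    ∃ t : ℕ → Set 𝒳, (∀ k, MeasurableSet (t k)) ∧
      {x | treeMessages q x n = u} = Set.pi (Finset.range n : Set ℕ) t ∧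
      ∀ m, ∏ k ∈ Finset.range n, (H.law m).real (t k)
        = pathWeight (fun k v b => H.msgProb m (q k v) b) n u := by
  induction n with
  | zero =>
    refine ⟨fun _ => Set.univ, fun _ => MeasurableSet.univ, ?_, fun m => by simp [pathWeight]⟩
    ext x
    simpa using Subsingleton.elim (treeMessages q x 0) u
  | succ n ih =>
    obtain ⟨t, ht, heq, hprod⟩ := ih (Fin.init u)
    set s : Set 𝒳 := {y | (q n (Fin.init u)).toFun y = u (Fin.last n)} with hs
    have hlt : ∀ k ∈ Finset.range n, Function.update t n s k = t k := fun k hk =>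
      Function.update_of_ne (Finset.mem_range.1 hk).ne _ _
    refine ⟨Function.update t n s, fun k => ?_, ?_, fun m => ?_⟩
    · by_cases hk : k = n
      · subst hk
        rw [Function.update_self]
        exact measurableSet_quantizer_eq _ _
      · simpa [hk] using ht k
    · ext x
      have hx : treeMessages q x n = Fin.init u ↔ ∀ k ∈ Finset.range n, x k ∈ t k := by
        have := Set.ext_iff.1 heq x
        simpa [Set.mem_pi] using this
      rw [Set.mem_ofPred_eq, treeMessages_succ_eq_iff, hx, Set.mem_pi]
      simp only [Finset.mem_coe]
      constructor
      · rintro ⟨h1, h2⟩ k hk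
        rw [Finset.range_add_one, Finset.mem_insert] at hk
        rcases hk with rfl | hk
        · simpa [hs] using h2
        · rw [hlt k hk]
          exact h1 k hk
      · intro h
        refine ⟨fun k hk => ?_, ?_⟩
        · rw [← hlt k hk]
          exact h k (Finset.mem_range.2 ((Finset.mem_range.1 hk).trans n.lt_succ_self))
        · simpa [hs] using h n (by simp)
    · rw [Finset.prod_range_succ, Finset.prod_congr rfl fun k hk => by rw [hlt k hk], hprod,
        Function.update_self]
      rfl

theorem measurableSet_treeMessages_eq (q : (n : ℕ) → (Fin n → Fin 2) → Quantizer 𝒳)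
    (n : ℕ) (u : Fin n → Fin 2) : MeasurableSet {x | treeMessages q x n = u} := by
  induction n with
  | zero => simp [Subsingleton.elim _ u]
  | succ n ih =>
    simp_rw [treeMessages_succ_eq_iff]
    exact (ih _).inter ((q n (Fin.init u)).measurable_toFun.comp (measurable_pi_apply n)
      (measurableSet_singleton _))

open scoped Classical in
theorem measureReal_treeMessages (m : Fin M) (q : (n : ℕ) → (Fin n → Fin 2) → Quantizer 𝒳)
    (n : ℕ) (P : (Fin n → Fin 2) → Prop) :
    (Measure.infinitePi fun _ : ℕ => H.law m).real {x | P (treeMessages q x n)}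
      = ∑ u, if P u then pathWeight (fun k v b => H.msgProb m (q k v) b) n u else 0 := by
  have hpt : ∀ u, (Measure.infinitePi fun _ : ℕ => H.law m).real {x | treeMessages q x n = u}
      = pathWeight (fun k v b => H.msgProb m (q k v) b) n u := by
    intro u
    obtain ⟨t, ht, heq, hprod⟩ := exists_treeMessages_eq_pi H q n u
    rw [heq, ← hprod m, measureReal_def, Measure.infinitePi_pi _ fun k _ => ht k,
      ENNReal.toReal_prod]
    rfl
  have h := sum_measureReal_preimage_singleton (μ := Measure.infinitePi fun _ : ℕ => H.law m)
    (f := fun x => treeMessages q x n) (Finset.univ.filter P)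
    fun u _ => measurableSet_treeMessages_eq q n u
  rw [← Finset.sum_filter, ← Finset.sum_congr rfl fun u _ => hpt u]
  refine Eq.trans ?_ h.symm
  congr 1
  ext x
  simp

/-- Lower bound for the number of messages in a sequential test without randomization, truncated
at the horizon `n`. -/
theorem sum_treeMessages_le (hH : H.PosFiniteDivergence) {m m' : Fin M} (hm : m' ≠ m)
    (q : (n : ℕ) → (Fin n → Fin 2) → Quantizer 𝒳) (S A : (n : ℕ) → (Fin n → Fin 2) → Prop)
    (s : ℝ) (n : ℕ) :
    s * (∑ k ∈ Finset.range n, (Measure.infinitePi fun _ : ℕ => H.law m).real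
          {x | (Alive S k (treeMessages q x k) ∧ S k (treeMessages q x k)) ∧
            A k (treeMessages q x k)})
      - (Real.exp s - 1) * (∑ k ∈ Finset.range n, (Measure.infinitePi fun _ : ℕ => H.law m').real
          {x | (Alive S k (treeMessages q x k) ∧ S k (treeMessages q x k)) ∧
            A k (treeMessages q x k)})
      ≤ ∑ k ∈ Finset.range n, ∑ u : Fin k → Fin 2,
          (Measure.infinitePi fun _ : ℕ => H.law m).real
            {x | treeMessages q x k = u ∧ Alive S k u ∧ ¬ S k u} * H.infoDet m m' (q k u) := by
  classical
  have h := sum_stopped_add_sum_alive_le (p := fun k v b => H.msgProb m (q k v) b)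
    (q := fun k v b => H.msgProb m' (q k v) b) (fun _ _ _ => msgProb_nonneg _ _ _)
    (fun _ _ _ => msgProb_nonneg _ _ _) (fun _ _ => sum_msgProb _ _)
    (fun _ _ => sum_msgProb _ _)
    -- The reward is `s` on stopping in `A` and zero otherwise; the value zero at the horizon makes
    -- paths still alive there contribute nothing to the left side.
    (fun _ _ => msgProb_eq_zero hH hm _) S (fun k u => if A k u then s else 0) n fun _ => 0
  simp only [mul_zero, Real.exp_zero, sub_self, ite_self, Finset.sum_const_zero, add_zero] at h
  refine Eq.trans_le ?_ (h.trans_eq ?_)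
  · rw [Finset.mul_sum, Finset.mul_sum, ← Finset.sum_sub_distrib]
    refine Finset.sum_congr rfl fun k _ => ?_
    rw [measureReal_treeMessages m q k fun u => (Alive S k u ∧ S k u) ∧ A k u,
      measureReal_treeMessages m' q k fun u => (Alive S k u ∧ S k u) ∧ A k u,
      Finset.mul_sum, Finset.mul_sum, ← Finset.sum_sub_distrib]
    refine Finset.sum_congr rfl fun u _ => ?_
    by_cases h1 : Alive S k u ∧ S k u <;> by_cases h2 : A k u <;> simp [h1, h2]
    ring
  · refine Finset.sum_congr rfl fun k _ => Finset.sum_congr rfl fun u _ => ?_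
    rw [measureReal_treeMessages m q k fun v => v = u ∧ Alive S k u ∧ ¬ S k u]
    by_cases h1 : Alive S k u ∧ ¬ S k u <;> simp [h1, infoDet]

/-- The average over alternatives is taken before bounding: against a single alternative a quantizer
may carry more than `I`, and only the weighted divergence at each node is controlled. -/
theorem sum_weights_treeMessages_le (hH : H.PosFiniteDivergence) (m : Fin M)
    {w : {m' : Fin M // m' ≠ m} → ℝ} (hw : ∀ m', 0 ≤ w m') (hw1 : ∑ m', w m' = 1) {I : ℝ}
    (hI : ∀ φ : Quantizer 𝒳, ∑ m', w m' * H.infoDet m m' φ ≤ I)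
    (q : (n : ℕ) → (Fin n → Fin 2) → Quantizer 𝒳) (S A : (n : ℕ) → (Fin n → Fin 2) → Prop)
    (s : ℝ) (n : ℕ) :
    s * (∑ k ∈ Finset.range n, (Measure.infinitePi fun _ : ℕ => H.law m).real
          {x | (Alive S k (treeMessages q x k) ∧ S k (treeMessages q x k)) ∧
            A k (treeMessages q x k)})
      - (Real.exp s - 1) * (∑ m', w m' *
        ∑ k ∈ Finset.range n, (Measure.infinitePi fun _ : ℕ => H.law m').real
          {x | (Alive S k (treeMessages q x k) ∧ S k (treeMessages q x k)) ∧
            A k (treeMessages q x k)})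
      ≤ I * ∑ k ∈ Finset.range n, (Measure.infinitePi fun _ : ℕ => H.law m).real
            {x | Alive S k (treeMessages q x k) ∧ ¬ S k (treeMessages q x k)} := by
  classical
  have h := Finset.sum_le_sum fun (m' : {m' : Fin M // m' ≠ m}) (_ : m' ∈ Finset.univ) =>
    mul_le_mul_of_nonneg_left (sum_treeMessages_le hH m'.2 q S A s n) (hw m')
  simp only [mul_sub, Finset.sum_sub_distrib, ← Finset.sum_mul, hw1, one_mul] at h
  refine Eq.trans_le ?_ (h.trans ?_)
  · congr 1
    rw [Finset.mul_sum]
    exact Finset.sum_congr rfl fun m' _ => by ring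
  · simp only [Finset.mul_sum]
    rw [Finset.sum_comm]
    refine Finset.sum_le_sum fun k _ => ?_
    rw [Finset.sum_comm, measureReal_treeMessages m q k fun u => Alive S k u ∧ ¬ S k u,
      Finset.mul_sum]
    refine Finset.sum_le_sum fun u _ => ?_
    rw [measureReal_treeMessages m q k fun v => v = u ∧ Alive S k u ∧ ¬ S k u]
    by_cases h1 : Alive S k u ∧ ¬ S k u
    · simp only [h1, not_false_eq_true, and_true, Finset.sum_ite_eq', Finset.mem_univ, if_true]
      have h2 := mul_le_mul_of_nonneg_right (hI (q k u)) (pathWeight_nonneg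
        (p := fun k v b => H.msgProb m (q k v) b) (fun _ _ _ => msgProb_nonneg _ _ _) k u)
      refine Eq.trans_le ?_ h2
      rw [Finset.sum_mul]
      exact Finset.sum_congr rfl fun m' _ => by ring
    · simp [h1]

end Hypotheses

/-! ### Randomized tests -/

/-- A linear inequality between measures of slices integrates to one between product measures. -/
theorem sum_mul_measureReal_prod_nonpos {ι X Y : Type*} [MeasurableSpace X] [MeasurableSpace Y]
    (s : Finset ι) (a : ι → ℝ) (κ : Measure X) [IsProbabilityMeasure κ] (ν : ι → Measure Y)
    [∀ i, IsProbabilityMeasure (ν i)] (E : ι → Set (X × Y)) (hE : ∀ i, MeasurableSet (E i))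
    (h : ∀ x, ∑ i ∈ s, a i * (ν i).real (Prod.mk x ⁻¹' E i) ≤ 0) :
    ∑ i ∈ s, a i * (κ.prod (ν i)).real (E i) ≤ 0 := by
  have hmeas : ∀ i, Measurable fun x => ν i (Prod.mk x ⁻¹' E i) := fun i =>
    measurable_measure_prodMk_left (hE i)
  have hint : ∀ i, Integrable (fun x => (ν i).real (Prod.mk x ⁻¹' E i)) κ := fun i =>
    Integrable.of_bound (hmeas i).ennreal_toReal.aestronglyMeasurable 1
      (Eventually.of_forall fun x => by
        rw [Real.norm_of_nonneg measureReal_nonneg]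
        exact measureReal_le_one)
  have heq : ∀ i, (κ.prod (ν i)).real (E i) = ∫ x, (ν i).real (Prod.mk x ⁻¹' E i) ∂κ := by
    intro i
    rw [measureReal_def, Measure.prod_apply (hE i), ← integral_toReal (hmeas i).aemeasurable
      (Eventually.of_forall fun x => measure_lt_top _ _)]
    rfl
  simp_rw [heq, ← integral_const_mul]
  rw [← integral_finsetSum _ fun i _ => (hint i).const_mul (a i)]
  exact integral_nonpos h

namespace DecentralizedTest

variable {𝒳 : Type*} [MeasurableSpace 𝒳] {M : ℕ} (δ : DecentralizedTest 𝒳 M)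

/-- The quantizer used after the messages `u`, once all the randomizations are fixed. -/
def treeQuantizer (ξ : δ.Fusion) (l : ℕ → δ.Local) (n : ℕ) (u : Fin n → Fin 2) : Quantizer 𝒳 where
  toFun x := δ.φ n x (l n) (δ.ψ n ξ u)
  measurable_toFun := (δ.measurable_φ n).comp
    (measurable_id.prodMk (measurable_const.prodMk measurable_const))

theorem messages_eq_treeMessages (ξ : δ.Fusion) (l : ℕ → δ.Local) (x : ℕ → 𝒳) (n : ℕ) :
    δ.messages (ξ, l, x) n = treeMessages (δ.treeQuantizer ξ l) x n := by
  induction n with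
  | zero => rfl
  | succ n ih => rw [messages, treeMessages, ih]; rfl

theorem measurable_messages (n : ℕ) : Measurable fun ω : δ.Sample => δ.messages ω n := by
  induction n with
  | zero => exact measurable_const
  | succ n ih =>
    have hψ : Measurable fun ω : δ.Sample => δ.ψ n ω.1 (δ.messages ω n) :=
      (measurable_from_prod_countable_left (f := fun a : δ.Fusion × (Fin n → Fin 2) =>
        δ.ψ n a.1 a.2) fun u => δ.measurable_ψ n u).comp (measurable_fst.prodMk ih)
    refine measurable_pi_iff.2 fun i => ?_
    refine Fin.lastCases ?_ (fun j => ?_) i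
    · simp only [messages, Fin.snoc_last]
      exact (δ.measurable_φ n).comp
        (((measurable_pi_apply n).comp (measurable_snd.comp measurable_snd)).prodMk
          (((measurable_pi_apply n).comp (measurable_fst.comp measurable_snd)).prodMk hψ))
    · simp only [messages, Fin.snoc_castSucc]
      exact (measurable_pi_apply j).comp ih

theorem measurableSet_halts_messages (n : ℕ) :
    MeasurableSet {ω : δ.Sample | δ.halts n ω.1 (δ.messages ω n)} := by
  have h : Measurable fun a : δ.Fusion × (Fin n → Fin 2) => δ.halts n a.1 a.2 :=
    measurable_from_prod_countable_left fun u => measurableSet_setOfPred.1 (δ.measurableSet_halts n u)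
  exact measurableSet_setOfPred.2 (h.comp (measurable_fst.prodMk (δ.measurable_messages n)))

theorem measurable_decision_messages (n : ℕ) :
    Measurable fun ω : δ.Sample => δ.decision n ω.1 (δ.messages ω n) :=
  (measurable_from_prod_countable_left (f := fun a : δ.Fusion × (Fin n → Fin 2) =>
    δ.decision n a.1 a.2) fun u => δ.measurable_decision n u).comp
    (measurable_fst.prodMk (δ.measurable_messages n))

/-- The event that the test continues after `n` messages, `N > n`. -/
def runningAt (n : ℕ) : Set δ.Sample :=
  {ω | ∀ j ≤ n, ¬ δ.halts j ω.1 (δ.messages ω j)}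

/-- The event that the test stops with `n` messages and decides for `m`. -/
def decidesAt (m : Fin M) (n : ℕ) : Set δ.Sample :=
  {ω | ((∀ j < n, ¬ δ.halts j ω.1 (δ.messages ω j)) ∧ δ.halts n ω.1 (δ.messages ω n)) ∧
    δ.decision n ω.1 (δ.messages ω n) = m}

theorem measurableSet_runningAt (n : ℕ) : MeasurableSet (δ.runningAt n) := by
  have : δ.runningAt n = ⋂ j ∈ Finset.range (n + 1), {ω | δ.halts j ω.1 (δ.messages ω j)}ᶜ := by
    ext ω
    simp [runningAt]
  rw [this]
  exact Finset.measurableSet_biInter _ fun j _ => (δ.measurableSet_halts_messages j).compl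

theorem measurableSet_decidesAt (m : Fin M) (n : ℕ) : MeasurableSet (δ.decidesAt m n) := by
  have : δ.decidesAt m n = ((⋂ j ∈ Finset.range n, {ω | δ.halts j ω.1 (δ.messages ω j)}ᶜ) ∩
      {ω | δ.halts n ω.1 (δ.messages ω n)}) ∩
      (fun ω : δ.Sample => δ.decision n ω.1 (δ.messages ω n)) ⁻¹' {m} := by
    ext ω
    simp [decidesAt]
  rw [this]
  exact ((Finset.measurableSet_biInter _ fun j _ => (δ.measurableSet_halts_messages j).compl).inter
    (δ.measurableSet_halts_messages n)).inter
    (δ.measurable_decision_messages n (measurableSet_singleton m))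

theorem alive_messages_iff (ω : δ.Sample) (n : ℕ) :
    Alive (fun k u => δ.halts k ω.1 u) n (δ.messages ω n) ↔
      ∀ j < n, ¬ δ.halts j ω.1 (δ.messages ω j) := by
  induction n with
  | zero => simp [Alive]
  | succ n ih =>
    simp only [Alive, messages, Fin.init_snoc, ih, Nat.lt_succ_iff_lt_or_eq]
    constructor
    · rintro ⟨h1, h2⟩ j (hj | rfl)
      exacts [h1 j hj, h2]
    · exact fun h => ⟨fun j hj => h j (Or.inl hj), h n (Or.inr rfl)⟩

theorem N_eq_of_halts {ω : δ.Sample} {n : ℕ} (h1 : ∀ j < n, ¬ δ.halts j ω.1 (δ.messages ω j))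
    (h2 : δ.halts n ω.1 (δ.messages ω n)) : δ.N ω = n := by
  refine le_antisymm (iInf₂_le n h2) (le_iInf₂ fun j hj => ?_)
  by_contra! hlt
  exact h1 j (by exact_mod_cast hlt) hj

theorem pairwiseDisjoint_decidesAt (m : Fin M) (s : Set ℕ) :
    s.PairwiseDisjoint (δ.decidesAt m) := by
  intro i _ j _ hij
  refine Set.disjoint_left.2 fun ω hi hj => ?_
  rcases lt_or_gt_of_ne hij with h | h
  · exact hj.1.1 i h hi.1.2
  · exact hi.1.1 j h hj.1.2

variable (H : Hypotheses 𝒳 M)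

instance (m : Fin M) : IsProbabilityMeasure (δ.prob H m) := by
  unfold prob
  infer_instance

theorem sum_weights_prob_le (hH : H.PosFiniteDivergence) (m : Fin M)
    {w : {m' : Fin M // m' ≠ m} → ℝ} (hw : ∀ m', 0 ≤ w m') (hw1 : ∑ m', w m' = 1) {I : ℝ}
    (hI : ∀ φ : Quantizer 𝒳, ∑ m', w m' * H.infoDet m m' φ ≤ I) (s : ℝ) (n : ℕ) :
    s * (∑ k ∈ Finset.range n, (δ.prob H m).real (δ.decidesAt m k))
      - (Real.exp s - 1) * (∑ m', w m' *
        ∑ k ∈ Finset.range n, (δ.prob H m').real (δ.decidesAt m k))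
      ≤ I * ∑ k ∈ Finset.range n, (δ.prob H m).real (δ.runningAt k) := by
  -- The inequality is encoded as one signed sum: `none` carries correct decisions under `m`, `some
  -- none` the running time under `m`, and `some (some m')` decisions for `m` under `m'`. It can
  -- then be integrated over the private randomizations and over that of the fusion center by the
  -- same lemma.
  let t : Finset (Option (Option {m' : Fin M // m' ≠ m}) × ℕ) := Finset.univ ×ˢ Finset.range n
  let a : Option (Option {m' : Fin M // m' ≠ m}) × ℕ → ℝ := fun i => match i.1 with
    | none => s
    | some none => -I
    | some (some m') => -((Real.exp s - 1) * w m')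
  let ρ : Option (Option {m' : Fin M // m' ≠ m}) × ℕ → Fin M := fun i => match i.1 with
    | some (some m') => m'
    | _ => m
  let E : Option (Option {m' : Fin M // m' ≠ m}) × ℕ → Set δ.Sample := fun i => match i.1 with
    | some none => δ.runningAt i.2
    | _ => δ.decidesAt m i.2
  have hE : ∀ i, MeasurableSet (E i) := by
    rintro ⟨_ | _ | m', k⟩
    exacts [δ.measurableSet_decidesAt m k, δ.measurableSet_runningAt k,
      δ.measurableSet_decidesAt m k]
  have key := sum_mul_measureReal_prod_nonpos t a δ.fusionLaw
    (fun i => (Measure.infinitePi fun _ : ℕ => δ.localLaw).prod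
      (Measure.infinitePi fun _ : ℕ => H.law (ρ i))) E hE fun ξ =>
    sum_mul_measureReal_prod_nonpos t a (Measure.infinitePi fun _ : ℕ => δ.localLaw)
      (fun i => Measure.infinitePi fun _ : ℕ => H.law (ρ i)) (fun i => Prod.mk ξ ⁻¹' E i)
      (fun i => measurable_prodMk_left (hE i)) fun l => by
        have h := Hypotheses.sum_weights_treeMessages_le hH m hw hw1 hI (δ.treeQuantizer ξ l)
          (fun k u => δ.halts k ξ u) (fun k u => δ.decision k ξ u = m) s n
        have hD : ∀ k, {x | (Alive (fun k u => δ.halts k ξ u) k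
              (treeMessages (δ.treeQuantizer ξ l) x k) ∧
              δ.halts k ξ (treeMessages (δ.treeQuantizer ξ l) x k)) ∧
              δ.decision k ξ (treeMessages (δ.treeQuantizer ξ l) x k) = m}
            = Prod.mk l ⁻¹' (Prod.mk ξ ⁻¹' δ.decidesAt m k) := by
          intro k
          ext x
          simp only [← messages_eq_treeMessages]
          exact and_congr_left' (and_congr_left' (δ.alive_messages_iff (ξ, l, x) k))
        have hR : ∀ k, {x | Alive (fun k u => δ.halts k ξ u) k
              (treeMessages (δ.treeQuantizer ξ l) x k) ∧
              ¬ δ.halts k ξ (treeMessages (δ.treeQuantizer ξ l) x k)}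
            = Prod.mk l ⁻¹' (Prod.mk ξ ⁻¹' δ.runningAt k) := by
          intro k
          ext x
          simp only [← messages_eq_treeMessages]
          have h1 := δ.alive_messages_iff (ξ, l, x) (k + 1)
          simp only [Alive, messages, Fin.init_snoc, Nat.lt_succ_iff] at h1
          exact h1
        simp only [hD, hR] at h
        simp only [t, a, ρ, E, Finset.sum_product, Fintype.sum_option]
        simp only [mul_assoc, neg_mul, Finset.sum_neg_distrib, ← Finset.mul_sum]
        linarith
  simp only [t, a, ρ, E, Finset.sum_product, Fintype.sum_option] at key
  simp only [mul_assoc, neg_mul, Finset.sum_neg_distrib, ← Finset.mul_sum] at key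
  simp only [prob]
  linarith

theorem sum_prob_decidesAt_le_errorProb {m m' : Fin M} (hm : m' ≠ m) (n : ℕ) :
    ∑ k ∈ Finset.range n, (δ.prob H m').real (δ.decidesAt m k) ≤ δ.errorProb H m' := by
  rw [← measureReal_biUnion_finset (δ.pairwiseDisjoint_decidesAt m _)
    fun k _ => δ.measurableSet_decidesAt m k]
  refine measureReal_mono fun ω hω => ?_
  obtain ⟨k, -, hk⟩ := Set.mem_iUnion₂.1 hω
  exact ⟨k, δ.N_eq_of_halts hk.1.1 hk.1.2, fun h => hm (h.symm.trans hk.2)⟩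

/-- The left side is `E_m[min(N, n)]`: every `k` with `N > k` is counted once. -/
theorem sum_prob_runningAt_le_expectedN (m : Fin M) (n : ℕ) :
    ∑ k ∈ Finset.range n, δ.prob H m (δ.runningAt k) ≤ δ.expectedN H m := by
  simp_rw [← fun k => lintegral_indicator_one (μ := δ.prob H m) (δ.measurableSet_runningAt k)]
  rw [← lintegral_finsetSum _ fun k _ => measurable_one.indicator (δ.measurableSet_runningAt k)]
  refine lintegral_mono fun ω => ?_
  classical
  rw [Finset.sum_congr rfl fun k _ => Set.indicator_apply _ _ _]
  simp only [Pi.one_apply]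
  rw [← Finset.sum_filter, Finset.sum_const, nsmul_eq_mul, mul_one]
  have hle : (((Finset.range n).filter fun k => ω ∈ δ.runningAt k).card : ℕ∞) ≤ δ.N ω := by
    refine le_iInf₂ fun j hj => ?_
    have hsub : ((Finset.range n).filter fun k => ω ∈ δ.runningAt k) ⊆ Finset.range j := by
      intro k hk
      rw [Finset.mem_filter] at hk
      rw [Finset.mem_range]
      by_contra! hjk
      exact hk.2 j hjk hj
    exact_mod_cast (Finset.card_le_card hsub).trans_eq (Finset.card_range j)
  exact_mod_cast ENat.toENNReal_le.2 hle

/-- Either the test decides for `m` before the horizon, or it errs, or it is still running; Markov's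
inequality bounds the last event. -/
theorem one_le_sum_prob_decidesAt_add (m : Fin M) (n : ℕ) (hn : 0 < n)
    (hN : δ.expectedN H m ≠ ∞) :
    1 ≤ ∑ k ∈ Finset.range n, (δ.prob H m).real (δ.decidesAt m k) + δ.errorProb H m
      + (δ.expectedN H m).toReal / n := by
  obtain ⟨n, rfl⟩ := Nat.exists_eq_succ_of_ne_zero hn.ne'
  have hanti : Antitone δ.runningAt := fun i j hij ω hω k hk => hω k (hk.trans hij)
  have hR : (n.succ : ℝ) * (δ.prob H m).real (δ.runningAt n) ≤ (δ.expectedN H m).toReal := by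
    have h1 := ENNReal.toReal_mono hN (δ.sum_prob_runningAt_le_expectedN H m n.succ)
    rw [ENNReal.toReal_sum fun k _ => measure_ne_top _ _] at h1
    refine le_trans ?_ h1
    have h2 := Finset.card_nsmul_le_sum (Finset.range n.succ)
      (fun k => (δ.prob H m).real (δ.runningAt k)) ((δ.prob H m).real (δ.runningAt n))
      fun k hk => measureReal_mono (hanti (Nat.lt_succ_iff.1 (Finset.mem_range.1 hk)))
    rwa [Finset.card_range, nsmul_eq_mul] at h2
  have hcover : (Set.univ : Set δ.Sample) ⊆
      ((⋃ k ∈ Finset.range n.succ, δ.decidesAt m k) ∪ δ.wrongDecision m) ∪ δ.runningAt n := by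
    intro ω _
    by_cases hω : ω ∈ δ.runningAt n
    · exact Or.inr hω
    · left
      have hex : ∃ j, j ≤ n ∧ δ.halts j ω.1 (δ.messages ω j) := by
        simpa [runningAt] using hω
      classical
      have hex' : ∃ j, δ.halts j ω.1 (δ.messages ω j) := hex.imp fun _ h => h.2
      obtain ⟨j, hjn, hj⟩ := hex
      have hfirst : ∀ i < Nat.find hex', ¬ δ.halts i ω.1 (δ.messages ω i) := fun i hi =>
        Nat.find_min hex' hi
      by_cases hd : δ.decision (Nat.find hex') ω.1 (δ.messages ω (Nat.find hex')) = m
      · left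
        exact Set.mem_iUnion₂.2 ⟨_, Finset.mem_range.2
          (Nat.lt_succ_iff.2 ((Nat.find_min' hex' hj).trans hjn)),
          ⟨hfirst, Nat.find_spec hex'⟩, hd⟩
      · right
        exact ⟨_, δ.N_eq_of_halts hfirst (Nat.find_spec hex'), hd⟩
  have h1 : 1 ≤ (δ.prob H m).real (((⋃ k ∈ Finset.range n.succ, δ.decidesAt m k)
      ∪ δ.wrongDecision m) ∪ δ.runningAt n) := by
    rw [← probReal_univ (μ := δ.prob H m)]
    exact measureReal_mono hcover
  have h2 := measureReal_union_le (μ := δ.prob H m)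
    ((⋃ k ∈ Finset.range n.succ, δ.decidesAt m k) ∪ δ.wrongDecision m) (δ.runningAt n)
  have h3 := measureReal_union_le (μ := δ.prob H m)
    (⋃ k ∈ Finset.range n.succ, δ.decidesAt m k) (δ.wrongDecision m)
  rw [measureReal_biUnion_finset (δ.pairwiseDisjoint_decidesAt m _)
    fun k _ => δ.measurableSet_decidesAt m k] at h3
  have h4 : (δ.prob H m).real (δ.runningAt n) ≤ (δ.expectedN H m).toReal / n.succ := by
    rw [le_div_iff₀ (by positivity)]
    linarith
  rw [errorProb]
  linarith

/-- Nonasymptotic lower bound for the expected number of messages, in terms of a common bound `α`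
for the error probabilities. -/
theorem mul_one_sub_le_maximinInfo_mul_expectedN (hM : 2 ≤ M) (hH : H.PosFiniteDivergence)
    (m : Fin M) {α s : ℝ} (hs : 0 ≤ s) (hα : ∀ m', δ.errorProb H m' ≤ α)
    (hN : δ.expectedN H m ≠ ∞) :
    s * (1 - α) - (Real.exp s - 1) * α ≤ H.maximinInfo m * (δ.expectedN H m).toReal := by
  obtain ⟨w, hw, hw1, hI⟩ := Hypotheses.exists_weights_sum_mul_infoDet_le hM hH m
  have hIpos := Hypotheses.maximinInfo_pos hM hH m
  have hbound : ∀ n : ℕ, s * (1 - α) - (Real.exp s - 1) * α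
      ≤ H.maximinInfo m * (δ.expectedN H m).toReal
        + s * ((δ.expectedN H m).toReal / ((n : ℝ) + 1)) := by
    intro n
    have h1 := δ.sum_weights_prob_le H hH m hw hw1 hI s (n + 1)
    have h2 := δ.one_le_sum_prob_decidesAt_add H m (n + 1) n.succ_pos hN
    have h3 : ∑ k ∈ Finset.range (n + 1), (δ.prob H m).real (δ.runningAt k)
        ≤ (δ.expectedN H m).toReal := by
      have := ENNReal.toReal_mono hN (δ.sum_prob_runningAt_le_expectedN H m (n + 1))
      rwa [ENNReal.toReal_sum fun k _ => measure_ne_top _ _] at this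
    have h4 : ∑ m', w m' * ∑ k ∈ Finset.range (n + 1), (δ.prob H m').real (δ.decidesAt m k)
        ≤ α := by
      calc _ ≤ ∑ m', w m' * α := Finset.sum_le_sum fun m' _ => mul_le_mul_of_nonneg_left
            ((δ.sum_prob_decidesAt_le_errorProb H m'.2 (n + 1)).trans (hα m')) (hw m')
        _ = α := by rw [← Finset.sum_mul, hw1, one_mul]
    have h5 := mul_le_mul_of_nonneg_left h3 hIpos.le
    have h6 := mul_le_mul_of_nonneg_left h4 (sub_nonneg.2 (Real.one_le_exp hs))
    have h7 := mul_le_mul_of_nonneg_left h2 hs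
    have h8 := mul_le_mul_of_nonneg_left (hα m) hs
    push_cast at h7
    linarith
  -- Finiteness of `E_m N` makes the truncation error vanish as the horizon grows.
  have hlim : Tendsto (fun n : ℕ => H.maximinInfo m * (δ.expectedN H m).toReal
      + s * ((δ.expectedN H m).toReal / ((n : ℝ) + 1))) atTop
      (𝓝 (H.maximinInfo m * (δ.expectedN H m).toReal + s * 0)) := by
    refine tendsto_const_nhds.add (Tendsto.const_mul s ?_)
    exact tendsto_const_nhds.div_atTop
      (tendsto_atTop_add_const_right _ _ tendsto_natCast_atTop_atTop)
  simpa using ge_of_tendsto' hlim hbound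

theorem neg_log_sub_two_div_le_expectedN (hM : 2 ≤ M) (hH : H.PosFiniteDivergence)
    (m : Fin M) {α : ℝ} (hα0 : 0 < α) (hα1 : α ≤ 1) (hα : ∀ m', δ.errorProb H m' ≤ α) :
    ENNReal.ofReal ((-Real.log α - 2) / H.maximinInfo m) ≤ δ.expectedN H m := by
  by_cases hN : δ.expectedN H m = ∞
  · rw [hN]
    exact le_top
  -- With `s = -log α`, the term `(exp s - 1) * α` equals `1 - α`, and `s * α ≤ 1 - α` because `s +
  -- 1 ≤ exp s`. The total loss is thus at most `2`.
  have h := δ.mul_one_sub_le_maximinInfo_mul_expectedN H hM hH m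
    (neg_nonneg.2 (Real.log_nonpos hα0.le hα1)) hα hN
  refine ENNReal.ofReal_le_of_le_toReal ?_
  rw [div_le_iff₀ (Hypotheses.maximinInfo_pos hM hH m)]
  rw [Real.exp_neg, Real.exp_log hα0, sub_mul, inv_mul_cancel₀ hα0.ne'] at h
  have h1 := Real.add_one_le_exp (-Real.log α)
  rw [Real.exp_neg, Real.exp_log hα0] at h1
  have h2 := mul_le_mul_of_nonneg_right h1 hα0.le
  rw [inv_mul_cancel₀ hα0.ne'] at h2
  linarith

end DecentralizedTest

/-! ### Asymptotics as the cost tends to zero -/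

theorem tendsto_abs_log_nhdsGT_zero : Tendsto (fun c : ℝ => |Real.log c|) (𝓝[>] 0) atTop :=
  tendsto_abs_atBot_atTop.comp Real.tendsto_log_nhdsGT_zero

theorem isEquivalent_abs_log_sub_div (r I : ℝ) :
    (fun c => (|Real.log c| - Real.log |Real.log c| + r) / I)
      ~[𝓝[>] 0] fun c => |Real.log c| / I := by
  have h1 : (fun x : ℝ => x - Real.log x + r) ~[atTop] fun x => x := by
    have h2 : (fun x : ℝ => -Real.log x + r) =o[atTop] fun x => x :=
      Real.isLittleO_log_id_atTop.neg_left.add (isLittleO_const_id_atTop r)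
    refine h2.congr_left fun x => ?_
    simp only [Pi.sub_apply]
    ring
  exact (h1.comp_tendsto tendsto_abs_log_nhdsGT_zero).div IsEquivalent.refl

end

theorem theorem4p2 {𝒳 : Type*} [MeasurableSpace 𝒳] {M : ℕ} (hM : 2 ≤ M)
    (H : Hypotheses 𝒳 M) (hH : H.PosFiniteDivergence)
    (δ : ℝ → DecentralizedTest 𝒳 M)
    (hδ : ∀ m : Fin M, (fun c : ℝ => (δ c).errorProb H m) =O[𝓝[>] 0] fun c => c * Real.log c)
    (m : Fin M) :
    BddAbove (Set.range (H.leastInfo m)) ∧ 0 < H.maximinInfo m ∧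
      ∃ r : ℝ → ℝ, r =O[𝓝[>] 0] (fun _ => (1 : ℝ)) ∧
        (∀ᶠ c in 𝓝[>] 0,
          ENNReal.ofReal
              ((|Real.log c| - Real.log |Real.log c| + r c) / H.maximinInfo m)
            ≤ (δ c).expectedN H m) ∧
        (fun c => (|Real.log c| - Real.log |Real.log c| + r c) / H.maximinInfo m)
          ~[𝓝[>] 0] fun c => |Real.log c| / H.maximinInfo m := by
  -- Boundedness expresses `I(m) < ∞`: a real supremum over an unbounded set would default to `0`.
  refine ⟨Hypotheses.bddAbove_range_leastInfo hM hH m, Hypotheses.maximinInfo_pos hM hH m, ?_⟩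
  choose C hC hCle using fun m' => (hδ m').exists_pos
  have hKpos : 0 < ∑ m', C m' := Finset.sum_pos (fun m' _ => hC m') ⟨m, Finset.mem_univ m⟩
  set K := ∑ m', C m'
  -- The sum `K` dominates every error constant, so `α = K * (c * |log c|)` serves all states.
  -- Expanding `-log α - 2` leaves this constant remainder.
  refine ⟨fun _ => -Real.log K - 2, isBigO_const_const _ one_ne_zero _, ?_,
    isEquivalent_abs_log_sub_div _ _⟩
  have hlim : Tendsto (fun c : ℝ => K * |c * Real.log c|) (𝓝[>] 0) (𝓝 0) := by
    have h : Tendsto (fun c : ℝ => c * Real.log c) (𝓝[>] 0) (𝓝 0) := by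
      have h1 := (Real.continuous_mul_log.tendsto 0).mono_left
        (nhdsWithin_le_nhds (s := Set.Ioi (0 : ℝ)))
      simpa using h1
    simpa using h.abs.const_mul K
  have herr : ∀ᶠ c in 𝓝[>] (0 : ℝ), ∀ m', (δ c).errorProb H m' ≤ K * |c * Real.log c| := by
    refine eventually_all.2 fun m' => ?_
    filter_upwards [(hCle m').bound] with c hc
    refine (le_abs_self _).trans (hc.trans ?_)
    exact mul_le_mul_of_nonneg_right
      (Finset.single_le_sum (fun j _ => (hC j).le) (Finset.mem_univ m')) (abs_nonneg _)
  filter_upwards [herr, hlim.eventually_le_const one_pos,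
    tendsto_abs_log_nhdsGT_zero.eventually_gt_atTop 0, self_mem_nhdsWithin,
    nhdsWithin_le_nhds (Iio_mem_nhds one_pos)] with c hc hc1 hlog hc0 hclt
  have hc0' : 0 < c := hc0
  have habs : |c * Real.log c| = c * |Real.log c| := by rw [abs_mul, abs_of_pos hc0']
  rw [habs] at hc hc1
  have h := (δ c).neg_log_sub_two_div_le_expectedN H hM hH m
    (mul_pos hKpos (mul_pos hc0' hlog)) hc1 hc
  rw [Real.log_mul hKpos.ne' (mul_pos hc0' hlog).ne', Real.log_mul hc0'.ne' hlog.ne'] at h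
  have hval : |Real.log c| - Real.log |Real.log c| + (-Real.log K - 2)
      = -(Real.log K + (Real.log c + Real.log |Real.log c|)) - 2 := by
    rw [abs_of_neg (Real.log_neg hc0' hclt)]
    ring
  rwa [hval]
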